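/- Let $n\ge 1$ and $d\ge 1$ be integers, let $F_d = x_1^d+\cdots+x_n^d$, let $X_{\rm Fer}\subset\mathbb{P}^{n-1}(\mathbb{C})$ be the hypersurface $F_d=0$, and let $U_{\rm Fer}=\mathbb{P}^{n-1}(\mathbb{C})\setminus X_{\rm Fer}$. Put $$\Omega=\sum_{i=1}^n(-1)^i x_i\,dx_1\wedge\cdots\wedge\widehat{dx_i}\wedge\cdots\wedge dx_n ,$$ and for $\boldsymbol{c}=(c_1,\dots,c_n)\in\mathbb{Z}_{>0}^n$ with $|\boldsymbol{c}|:=c_1+\cdots+c_n=dr$, where $r$ is a positive integer, let $$\omega_{\boldsymbol{c}}=\frac{x_1^{c_1-1}\cdots x_n^{c_n-1}}{F_d^{\,r}}\,\Omega ,$$ which is a holomorphic $(n-1)$-form on $U_{\rm Fer}$. Then there exists a homology class $[\delta_0]$ in the singular homology group $H_{n-1}(U_{\rm Fer},\mathbb{Q})$, represented by a smooth singular cycle $\delta_0$ with rational coefficients, such that for all $\boldsymbol{c}\in\mathbb{Z}_{>0}^n$ and all positive integers $r$ with $|\boldsymbol{c}|=dr$, $$\int_{\delta_0}\omega_{\boldsymbol{c}}=(2\pi\sqrt{-1})^n\,\frac{(-1)^r}{\Gamma(r)\prod_{i=1}^n\Gamma\!\left(1-\frac{c_i}{d}\right)}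 ,$$ where $1/\Gamma(s)$ is understood to be $0$ when $s$ is a non-positive integer. -/

import Mathlib

open scoped ContDiff LinearAlgebra.Projectivization Simplicial

noncomputable section

namespace FermatPeriod

/-! ### Projective space and the complement of the Fermat hypersurface

Throughout, `n = m + 1` is the number of homogeneous coordinates, so that the projective space
has dimension `m = n - 1`. -/

/-- Complex projective space, as the set of lines in `ℂⁿ`, carries the quotient topology
from `ℂⁿ ∖ {0}`. -/
instance projectiveTopology (m : ℕ) : TopologicalSpace (ℙ ℂ (Fin (m + 1) → ℂ)) :=
  inferInstanceAs
    (TopologicalSpace (Quotient (projectivizationSetoid ℂ (Fin (m + 1) → ℂ))))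

/-- The Fermat polynomial `F_d = x_1 ^ d + ... + x_n ^ d`. -/
def fermat (m d : ℕ) (x : Fin (m + 1) → ℂ) : ℂ := ∑ i, x i ^ d

/-- The complement `U_Fer` of the Fermat hypersurface `F_d = 0` in the projective space. Since
`F_d` is homogeneous, its non-vanishing can be tested on any representative. -/
abbrev FermatComplement (m d : ℕ) : Type :=
  {p : ℙ ℂ (Fin (m + 1) → ℂ) // fermat m d p.rep ≠ 0}

/-! ### The differential form -/

/-- The constant `m`-form `dx_1 ∧ ... ∧ dx_n` with the factor `dx_i` omitted: its value on
`w_1, ..., w_m` is the determinant of the coordinates of the `w_a` other than the `i`-th one. -/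
def dxOmit {m : ℕ} (i : Fin (m + 1)) : (Fin (m + 1) → ℂ) [⋀^Fin m]→ₗ[ℂ] ℂ :=
  (Matrix.detRowAlternating (n := Fin m) (R := ℂ)).compLinearMap
    (LinearMap.funLeft ℂ ℂ i.succAbove)

/-- `Ω = ∑ i, (-1) ^ i x_i dx_1 ∧ ... ∧ dx_n` (the factor `dx_i` omitted), the index `i` running
from `1` to `n`; the coordinate numbered `i + 1` there is the one indexed by `i : Fin n` here. -/
def eulerForm {m : ℕ} (x : Fin (m + 1) → ℂ) : (Fin (m + 1) → ℂ) [⋀^Fin m]→ₗ[ℂ] ℂ :=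
  ∑ i : Fin (m + 1), ((-1) ^ ((i : ℕ) + 1) * x i) • dxOmit i

/-- The form `ω_c = x_1 ^ (c_1 - 1) ⋯ x_n ^ (c_n - 1) / F_d ^ r · Ω` on the cone `F_d ≠ 0`, for
positive integers `c_i`. When `|c| = d r` it is homogeneous of degree zero and is killed by
contraction with the Euler vector field, so that it is the pullback of a form on
`FermatComplement m d`, for which we use the same name. -/
def fermatForm (m d : ℕ) (c : Fin (m + 1) → ℕ) (r : ℕ) (x : Fin (m + 1) → ℂ) :
    (Fin (m + 1) → ℂ) [⋀^Fin m]→ₗ[ℂ] ℂ :=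
  ((∏ i, x i ^ (c i - 1)) / fermat m d x ^ r) • eulerForm x

/-! ### Affine charts of the projective space -/

/-- The representative of `p` whose `i`-th homogeneous coordinate is `1` (for `p` in the chart
`x_i ≠ 0`). Its other entries are the affine coordinates of `p` in this chart, and it is a
holomorphic section over the chart of the projection from `ℂⁿ ∖ {0}`. -/
def normalized {m : ℕ} (i : Fin (m + 1)) (p : ℙ ℂ (Fin (m + 1) → ℂ)) : Fin (m + 1) → ℂ :=
  (p.rep i)⁻¹ • p.rep

theorem exists_rep_ne_zero {m : ℕ} (p : ℙ ℂ (Fin (m + 1) → ℂ)) : ∃ i, p.rep i ≠ 0 :=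
  Function.ne_iff.mp p.rep_nonzero

/-- Some chart `x_i ≠ 0` that contains `p`. -/
def chartAt {m : ℕ} (p : ℙ ℂ (Fin (m + 1) → ℂ)) : Fin (m + 1) := (exists_rep_ne_zero p).choose

/-! ### Smooth singular simplices and integration -/

/-- The simplex `{u ∈ ℝ^m | u_j ≥ 0, u_1 + ... + u_m ≤ 1}`. -/
def corner (m : ℕ) : Set (Fin m → ℝ) := {u | (∀ j, 0 ≤ u j) ∧ ∑ j, u j ≤ 1}

/-- The affine parametrization `u ↦ (1 - u_1 - ... - u_m, u_1, ..., u_m)` of the standard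
`m`-simplex by `corner m`, which orients the standard simplex by the order of its vertices.
(Outside `corner m` the value is irrelevant.) -/
def simplexPoint {m : ℕ} (u : Fin m → ℝ) : stdSimplex ℝ (Fin (m + 1)) :=
  open Classical in
  if h : u ∈ corner m then
    ⟨Fin.cons (1 - ∑ j, u j) u, by
      refine ⟨fun i => ?_, by simp [Fin.sum_univ_succ]⟩
      refine Fin.cases ?_ (fun j => ?_) i
      · simpa using h.2
      · simpa using h.1 j⟩
  else stdSimplex.vertex 0

/-- The set of singular `k`-simplices of `U_Fer`. -/
abbrev SingularSimplex (m d k : ℕ) : Type :=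
  (TopCat.toSSet.obj (TopCat.of (FermatComplement m d))) _⦋k⦌

/-- A singular `m`-simplex of `U_Fer`, as a continuous map on the standard simplex, in terms of
the coordinates `u`. -/
def SingularSimplex.eval {m d : ℕ} (σ : SingularSimplex m d m) (u : Fin m → ℝ) :
    ℙ ℂ (Fin (m + 1) → ℂ) :=
  ((TopCat.toSSetObjEquiv (TopCat.of (FermatComplement m d)) (.op ⦋m⦌) σ)
    (simplexPoint u) : FermatComplement m d).1

/-- A singular simplex is smooth if, in every affine chart of the projective space, it is given
by functions that are `C^∞` on the closed simplex, up to the boundary. -/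
def IsSmooth {m d : ℕ} (σ : SingularSimplex m d m) : Prop :=
  ∀ i : Fin (m + 1), ∀ u ∈ corner m, (σ.eval u).rep i ≠ 0 →
    ContDiffWithinAt ℝ ∞ (fun u' => normalized i (σ.eval u')) (corner m) u

/-- The smooth singular `m`-simplices of `U_Fer`. -/
abbrev SmoothSimplex (m d : ℕ) : Type := {σ : SingularSimplex m d m // IsSmooth σ}

/-- The integral over the smooth simplex `σ` of the form on `U_Fer` whose pullback to the cone is
`η`. The pullback of the form along `σ` is computed, at each point of the simplex, by lifting `σ`
through the section `normalized i` of a chart that contains the point; the function so obtained,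
`(σ^* η)(∂/∂u_1, ..., ∂/∂u_m)`, is integrated over `corner m`. -/
def SmoothSimplex.integral {m d : ℕ} (σ : SmoothSimplex m d)
    (η : (Fin (m + 1) → ℂ) → (Fin (m + 1) → ℂ) [⋀^Fin m]→ₗ[ℂ] ℂ) : ℂ :=
  ∫ u in corner m,
    η (normalized (chartAt (σ.1.eval u)) (σ.1.eval u)) (fun a =>
      fderivWithin ℝ (fun u' => normalized (chartAt (σ.1.eval u)) (σ.1.eval u'))
        (corner m) u (Pi.single a 1))

/-- Smooth singular `m`-chains of `U_Fer` with rational coefficients. -/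
abbrev SmoothChain (m d : ℕ) : Type := SmoothSimplex m d →₀ ℚ

/-- The integral of a form over a smooth chain. -/
def SmoothChain.integral {m d : ℕ} (z : SmoothChain m d)
    (η : (Fin (m + 1) → ℂ) → (Fin (m + 1) → ℂ) [⋀^Fin m]→ₗ[ℂ] ℂ) : ℂ :=
  z.sum fun σ a => (a : ℂ) * SmoothSimplex.integral σ η

/-! ### Rational homology -/

/-- The singular chain complex of `U_Fer` with rational coefficients. -/
abbrev chains (m d : ℕ) : ChainComplex (ModuleCat.{0} ℚ) ℕ :=
  ((AlgebraicTopology.singularChainComplexFunctor (ModuleCat.{0} ℚ)).obj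
    (ModuleCat.of ℚ ℚ)).obj (TopCat.of (FermatComplement m d))

/-- The singular (Betti) homology group `H_k(U_Fer, ℚ)`. -/
abbrev BettiHomology (m d k : ℕ) : ModuleCat.{0} ℚ :=
  ((AlgebraicTopology.singularHomologyFunctor (ModuleCat.{0} ℚ) k).obj
    (ModuleCat.of ℚ ℚ)).obj (TopCat.of (FermatComplement m d))

/-- A smooth chain, as an element of the singular chain complex. -/
def SmoothChain.toChain {m d : ℕ} (z : SmoothChain m d) : (chains m d).X m :=
  z.sum fun σ a =>
    ((TopCat.toSSet.obj (TopCat.of (FermatComplement m d))).ιChainComplex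
      (R := ModuleCat.of ℚ ℚ) σ.1).hom a

/-- The smooth chain `z` is a cycle and its homology class is `δ`. -/
def SmoothChain.Represents {m d : ℕ} (z : SmoothChain m d) (δ : BettiHomology m d m) : Prop :=
  ∃ w : (chains m d).cycles m,
    ((chains m d).iCycles m).hom w = z.toChain ∧ ((chains m d).homologyπ m).hom w = δ

end FermatPeriod

end

noncomputable section

namespace FermatPeriod

/-! ### The forms `Ω` and `ω_c` -/

/-! The cycle is a Pham-type join. With `ζ = exp (2πi/d)`, take for each set `S` of coordinates the
simplex `t ↦ [g_1 t_1 : ... : g_n t_n]`, where `g_i = ζ` on `S` and `g_i = 1` elsewhere. It avoids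
the Fermat hypersurface because `F_d` restricts to `∑ t_i ^ d > 0`. With signs `(-1) ^ |Sᶜ|` the sum
is a cycle: the `i`-th face has `t_i = 0` and forgets `g_i`, so toggling `i` cancels faces in pairs
(`d_sum_eq_zero`). The form `ω_c` does not depend on the lift to the cone (`fermatForm_smul_add`)
and is multiplied by `∏ g_i ^ c_i` under `x ↦ g x` (`fermatForm_mul`). Each simplex therefore
contributes `-∏ g_i ^ c_i` times one real integral `J`, and the signed sum over `S` factors as `∏ (ζ
^ c_i - 1)`. Integrating `∏ y_i ^ (c_i - 1) exp (-y_i ^ d)` over the orthant, once as a product and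
once radially, gives `J = ∏ Γ(c_i/d) / (d ^ m Γ(r))` (`integral_corner`). The normalization `-d ^ m`
removes the sign and the power of `d`. Euler's reflection formula turns each `(ζ ^ c_i - 1)
Γ(c_i/d)` into `2πi exp (πi c_i/d) / Γ(1 - c_i/d)`, and the exponentials multiply to `exp (πi r) =
(-1) ^ r`. -/

theorem eulerForm_apply {m : ℕ} (x : Fin (m + 1) → ℂ) (w : Fin m → Fin (m + 1) → ℂ) :
    eulerForm x w = -(Matrix.of (Fin.cons x w : Fin (m + 1) → Fin (m + 1) → ℂ)).det := by
  -- Laplace expansion along the row `x`. Its signs start with `+`, those of `Ω` with `-` since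
  -- coordinates are numbered from 1; hence the global minus.
  rw [Matrix.det_succ_row_zero, ← Finset.sum_neg_distrib]
  have happ : ∀ (ι : Type) (s : Finset ι) (f : ι → (Fin (m + 1) → ℂ) [⋀^Fin m]→ₗ[ℂ] ℂ),
      (∑ i ∈ s, f i) w = ∑ i ∈ s, f i w := fun ι s f => by
    classical
    induction s using Finset.induction_on with
    | empty => simp
    | insert i s hi ih => simp [Finset.sum_insert hi, ih]
  rw [eulerForm, happ]
  simp only [AlternatingMap.smul_apply, smul_eq_mul]
  refine Finset.sum_congr rfl fun i _ => ?_
  have : (dxOmit i) w = ((Matrix.of (Fin.cons x w : Fin (m + 1) → Fin (m + 1) → ℂ)).submatrix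
      Fin.succ i.succAbove).det := rfl
  rw [this]
  simp [pow_succ]

/-- Multiples of the row `x` added to the other rows leave the determinant unchanged. The terms `b a
• x` are those produced by differentiating a change of lift. -/
theorem eulerForm_smul_add {m : ℕ} (s : ℂ) (x : Fin (m + 1) → ℂ) (w : Fin m → Fin (m + 1) → ℂ)
    (b : Fin m → ℂ) (hs : s ≠ 0) :
    eulerForm (s • x) (fun a => s • w a + b a • x) = s ^ (m + 1) * eulerForm x w := by
  have h := Matrix.det_smul (Matrix.of (Fin.cons x w : Fin (m + 1) → Fin (m + 1) → ℂ)) s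
  rw [Fintype.card_fin] at h
  rw [eulerForm_apply, eulerForm_apply, mul_neg, neg_inj, ← h]
  refine Matrix.det_eq_of_forall_row_eq_smul_add_const (Fin.cons 0 fun a => b a / s) 0 rfl ?_
  intro i j
  refine Fin.cases ?_ (fun a => ?_) i
  · simp
  · simp; field_simp

theorem eulerForm_mul {m : ℕ} (g x : Fin (m + 1) → ℂ) (w : Fin m → Fin (m + 1) → ℂ) :
    eulerForm (g * x) (fun a => g * w a) = (∏ i, g i) * eulerForm x w := by
  rw [eulerForm_apply, eulerForm_apply, mul_neg, neg_inj, ← Matrix.det_mul_row]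
  congr 1
  ext i j
  refine Fin.cases ?_ (fun a => ?_) i <;> simp

/-- The vector `e_{a+1} - e_0`, tangent to the simplex. -/
def edge {m : ℕ} (a : Fin m) : Fin (m + 1) → ℝ := Fin.cons (-1) (Pi.single a 1)

theorem eulerForm_edge {m : ℕ} (x : Fin (m + 1) → ℂ) :
    eulerForm x (fun a i => ((edge a i : ℝ) : ℂ)) = -∑ i, x i := by
  rw [eulerForm_apply, neg_inj]
  set A := Matrix.of (Fin.cons x (fun a i => ((edge a i : ℝ) : ℂ)) :
    Fin (m + 1) → Fin (m + 1) → ℂ) with hA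
  have h := Matrix.det_updateCol_sum A 0 (fun _ => 1)
  rw [one_smul] at h
  -- Column 0 is replaced by the sum of all columns. Edge vectors have coordinate sum zero, so only
  -- its top entry `∑ x i` survives, and the complementary minor is the identity.
  rw [← h, Matrix.det_succ_column_zero, Finset.sum_eq_single 0]
  · have : (A.updateCol 0 fun k => ∑ i, (1 : ℂ) • A k i).submatrix (Fin.succAbove 0) Fin.succ
        = 1 := by
      ext a b
      simp [hA, edge, Matrix.one_apply, Pi.single_apply, eq_comm, apply_ite Complex.ofReal]
    rw [this]
    simp [hA]
  · intro i _ hi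
    obtain ⟨a, rfl⟩ := Fin.exists_succ_eq.2 hi
    simp [hA, edge, Fin.sum_univ_succ, Pi.single_apply, apply_ite Complex.ofReal]
  · simp

theorem fermat_smul {m d : ℕ} (s : ℂ) (x : Fin (m + 1) → ℂ) :
    fermat m d (s • x) = s ^ d * fermat m d x := by
  simp [fermat, mul_pow, Finset.mul_sum]

theorem fermat_mul {m d : ℕ} {g : Fin (m + 1) → ℂ} (hg : ∀ i, g i ^ d = 1)
    (x : Fin (m + 1) → ℂ) : fermat m d (g * x) = fermat m d x := by
  simp [fermat, mul_pow, hg]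

theorem sum_sub_one_add {m : ℕ} {c : Fin (m + 1) → ℕ} (hc : ∀ i, 0 < c i) :
    ∑ i, (c i - 1) + (m + 1) = ∑ i, c i := by
  have : ∑ i, (c i - 1 + 1) = ∑ i, c i :=
    Finset.sum_congr rfl fun i _ => Nat.sub_add_cancel (hc i)
  rw [← this, Finset.sum_add_distrib]
  simp

/-- Degree count: the monomial has degree `|c| - n`, `Ω` has degree `n`, and `F_d ^ r` has degree `d
r = |c|`. This makes the integrand independent of the chart. -/
theorem fermatForm_smul_add {m d r : ℕ} {c : Fin (m + 1) → ℕ} (hc : ∀ i, 0 < c i)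
    (hr : ∑ i, c i = d * r) (s : ℂ) (hs : s ≠ 0) (x : Fin (m + 1) → ℂ)
    (w : Fin m → Fin (m + 1) → ℂ) (b : Fin m → ℂ) :
    fermatForm m d c r (s • x) (fun a => s • w a + b a • x) = fermatForm m d c r x w := by
  simp only [fermatForm, AlternatingMap.smul_apply, eulerForm_smul_add s x w b hs, fermat_smul,
    smul_eq_mul, Pi.smul_apply, mul_pow, Finset.prod_mul_distrib, Finset.prod_pow_eq_pow_sum]
  have h : s ^ (∑ i, (c i - 1)) * s ^ (m + 1) = (s ^ d) ^ r := by
    rw [← pow_add, sum_sub_one_add hc, hr, pow_mul]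
  have h' : (s ^ d) ^ r ≠ 0 := pow_ne_zero _ (pow_ne_zero _ hs)
  calc _ = (s ^ (∑ i, (c i - 1)) * s ^ (m + 1)) / (s ^ d) ^ r *
        ((∏ i, x i ^ (c i - 1)) / fermat m d x ^ r * eulerForm x w) := by ring
    _ = _ := by rw [h, div_self h', one_mul]

theorem fermatForm_mul {m d r : ℕ} {c : Fin (m + 1) → ℕ} (hc : ∀ i, 0 < c i)
    {g : Fin (m + 1) → ℂ} (hg : ∀ i, g i ^ d = 1) (x : Fin (m + 1) → ℂ)
    (w : Fin m → Fin (m + 1) → ℂ) :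
    fermatForm m d c r (g * x) (fun a => g * w a) =
      (∏ i, g i ^ c i) * fermatForm m d c r x w := by
  have h : ∏ i, g i ^ c i = (∏ i, g i ^ (c i - 1)) * ∏ i, g i := by
    rw [← Finset.prod_mul_distrib]
    exact Finset.prod_congr rfl fun i _ => (pow_sub_one_mul (hc i).ne' _).symm
  simp only [fermatForm, AlternatingMap.smul_apply, eulerForm_mul, fermat_mul hg,
    smul_eq_mul, Pi.mul_apply, mul_pow, Finset.prod_mul_distrib, h]
  ring

/-! ### The simplices `[g_1 t_1 : ... : g_n t_n]` -/

/-- The point with barycentric coordinates `(1 - u_1 - ... - u_m, u_1, ..., u_m)`. -/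
def barycentric {m : ℕ} (u : Fin m → ℝ) : Fin (m + 1) → ℝ := Fin.cons (1 - ∑ j, u j) u

theorem coe_simplexPoint {m : ℕ} {u : Fin m → ℝ} (hu : u ∈ corner m) :
    ((simplexPoint u : stdSimplex ℝ (Fin (m + 1))) : Fin (m + 1) → ℝ) = barycentric u := by
  simp only [simplexPoint, hu, dif_pos]; rfl

theorem sum_barycentric {m : ℕ} (u : Fin m → ℝ) : ∑ i, barycentric u i = 1 := by
  simp [barycentric, Fin.sum_univ_succ]

/-- The vector with entries `g_i t_i`. -/
def twist {m : ℕ} (g : Fin (m + 1) → ℂ) (t : Fin (m + 1) → ℝ) : Fin (m + 1) → ℂ :=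
  g * fun i => (t i : ℂ)

theorem fermat_twist {m d : ℕ} {g : Fin (m + 1) → ℂ} (hg : ∀ i, g i ^ d = 1)
    (t : Fin (m + 1) → ℝ) : fermat m d (twist g t) = ((∑ i, t i ^ d : ℝ) : ℂ) := by
  rw [twist, fermat_mul hg]
  simp [fermat]

theorem sum_pow_pos {m : ℕ} (d : ℕ) {t : Fin (m + 1) → ℝ}
    (ht : t ∈ stdSimplex ℝ (Fin (m + 1))) : 0 < ∑ i, t i ^ d := by
  obtain ⟨i, hi⟩ : ∃ i, 0 < t i := by
    by_contra! h
    have := Finset.sum_nonpos (s := Finset.univ) fun i _ => h i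
    rw [ht.2] at this
    exact absurd this (by norm_num)
  exact Finset.sum_pos' (fun j _ => pow_nonneg (ht.1 j) d) ⟨i, Finset.mem_univ _, pow_pos hi d⟩

theorem fermat_twist_ne_zero {m d : ℕ} {g : Fin (m + 1) → ℂ} (hg : ∀ i, g i ^ d = 1)
    {t : Fin (m + 1) → ℝ} (ht : t ∈ stdSimplex ℝ (Fin (m + 1))) :
    fermat m d (twist g t) ≠ 0 := by
  rw [fermat_twist hg]
  exact_mod_cast (sum_pow_pos d ht).ne'

theorem ne_zero_of_fermat_ne_zero {m d : ℕ} (hd : 0 < d) {x : Fin (m + 1) → ℂ}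
    (hx : fermat m d x ≠ 0) : x ≠ 0 := by
  rintro rfl
  simp [fermat, hd.ne'] at hx

theorem fermat_rep_mk_ne_zero {m d : ℕ} {x : Fin (m + 1) → ℂ} (hx : x ≠ 0)
    (h : fermat m d x ≠ 0) : fermat m d (Projectivization.mk ℂ x hx).rep ≠ 0 := by
  obtain ⟨a, ha⟩ := Projectivization.exists_smul_eq_mk_rep ℂ x hx
  rw [← ha, Units.smul_def, fermat_smul]
  exact mul_ne_zero (pow_ne_zero _ a.ne_zero) h

theorem normalized_mk {m : ℕ} (i : Fin (m + 1)) {x : Fin (m + 1) → ℂ} (hx : x ≠ 0) :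
    normalized i (Projectivization.mk ℂ x hx) = (x i)⁻¹ • x := by
  obtain ⟨a, ha⟩ := Projectivization.exists_smul_eq_mk_rep ℂ x hx
  have h0 : (a : ℂ) ≠ 0 := a.ne_zero
  rw [normalized, ← ha, Units.smul_def]
  ext j
  simp only [Pi.smul_apply, smul_eq_mul, mul_inv]
  field_simp

theorem rep_mk_ne_zero_iff {m : ℕ} (i : Fin (m + 1)) {x : Fin (m + 1) → ℂ} (hx : x ≠ 0) :
    (Projectivization.mk ℂ x hx).rep i ≠ 0 ↔ x i ≠ 0 := by
  obtain ⟨a, ha⟩ := Projectivization.exists_smul_eq_mk_rep ℂ x hx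
  rw [← ha, Units.smul_def]
  simp

theorem continuous_mk (m : ℕ) : Continuous fun x : {x : Fin (m + 1) → ℂ // x ≠ 0} =>
    Projectivization.mk ℂ x.1 x.2 :=
  continuous_quotient_mk' (s := projectivizationSetoid ℂ (Fin (m + 1) → ℂ))

theorem continuous_twist {m : ℕ} (g : Fin (m + 1) → ℂ) : Continuous (twist g) := by
  unfold twist
  fun_prop

/-- The point `[g_1 t_1 : ... : g_n t_n]` of `U_Fer`, for `d`-th roots of unity `g_i`. -/
def twistedMap {m d : ℕ} (hd : 0 < d) (g : Fin (m + 1) → ℂ) (hg : ∀ i, g i ^ d = 1) :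
    C(stdSimplex ℝ (Fin (m + 1)), FermatComplement m d) where
  toFun t :=
    ⟨Projectivization.mk ℂ (twist g t)
      (ne_zero_of_fermat_ne_zero hd (fermat_twist_ne_zero hg t.2)),
      fermat_rep_mk_ne_zero _ (fermat_twist_ne_zero hg t.2)⟩
  continuous_toFun := by
    have h : Continuous fun t : stdSimplex ℝ (Fin (m + 1)) =>
        (⟨twist g t, ne_zero_of_fermat_ne_zero hd (fermat_twist_ne_zero hg t.2)⟩ :
          {x : Fin (m + 1) → ℂ // x ≠ 0}) :=
      Continuous.subtype_mk ((continuous_twist g).comp continuous_subtype_val) _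
    exact Continuous.subtype_mk ((continuous_mk m).comp h) _

/-- The singular simplex `t ↦ [g_1 t_1 : ... : g_n t_n]`. -/
def twistedSimplex {m d : ℕ} (hd : 0 < d) (g : Fin (m + 1) → ℂ) (hg : ∀ i, g i ^ d = 1) :
    SingularSimplex m d m :=
  (TopCat.toSSetObjEquiv (TopCat.of (FermatComplement m d)) (.op ⦋m⦌)).symm (twistedMap hd g hg)

section

variable {m d : ℕ} (hd : 0 < d) (g : Fin (m + 1) → ℂ) (hg : ∀ i, g i ^ d = 1)

theorem eval_twistedSimplex (u : Fin m → ℝ) :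
    (twistedSimplex hd g hg).eval u = (twistedMap hd g hg (simplexPoint u)).1 := by
  simp only [SingularSimplex.eval, twistedSimplex, Equiv.apply_symm_apply]

theorem normalized_eval_twistedSimplex (i : Fin (m + 1)) {u : Fin m → ℝ} (hu : u ∈ corner m) :
    normalized i ((twistedSimplex hd g hg).eval u) =
      (twist g (barycentric u) i)⁻¹ • twist g (barycentric u) := by
  rw [eval_twistedSimplex, twistedMap, ContinuousMap.coe_mk, normalized_mk, coe_simplexPoint hu]

theorem rep_eval_twistedSimplex_ne_zero_iff (i : Fin (m + 1)) {u : Fin m → ℝ}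
    (hu : u ∈ corner m) : ((twistedSimplex hd g hg).eval u).rep i ≠ 0 ↔
      twist g (barycentric u) i ≠ 0 := by
  rw [eval_twistedSimplex, twistedMap, ContinuousMap.coe_mk, rep_mk_ne_zero_iff,
    coe_simplexPoint hu]

end

theorem contDiff_twist_barycentric {m : ℕ} (g : Fin (m + 1) → ℂ) :
    ContDiff ℝ ∞ fun u : Fin m → ℝ => twist g (barycentric u) := by
  rw [contDiff_pi]
  intro i
  refine contDiff_const.mul (Complex.ofRealCLM.contDiff.comp ?_)
  refine Fin.cases ?_ (fun j => ?_) i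
  · change ContDiff ℝ ∞ fun u : Fin m → ℝ => 1 - ∑ j, u j
    fun_prop
  · change ContDiff ℝ ∞ fun u : Fin m → ℝ => u j
    fun_prop

theorem isSmooth_twistedSimplex {m d : ℕ} (hd : 0 < d) (g : Fin (m + 1) → ℂ)
    (hg : ∀ i, g i ^ d = 1) : IsSmooth (twistedSimplex hd g hg) := by
  intro i u hu hi
  rw [rep_eval_twistedSimplex_ne_zero_iff hd g hg i hu] at hi
  refine ContDiffWithinAt.congr_of_mem (f := fun u' =>
    (twist g (barycentric u') i)⁻¹ • twist g (barycentric u')) ?_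
    (fun u' hu' => normalized_eval_twistedSimplex hd g hg i hu') hu
  have h := (contDiff_twist_barycentric g).contDiffAt (x := u)
  exact (((contDiffAt_pi.1 h i).inv hi).smul h).contDiffWithinAt

/-! ### The integrals over these simplices -/

theorem convex_corner (m : ℕ) : Convex ℝ (corner m) := by
  intro x hx y hy a b ha hb hab
  refine ⟨fun j => ?_, ?_⟩
  · exact add_nonneg (mul_nonneg ha (hx.1 j)) (mul_nonneg hb (hy.1 j))
  · simp only [Pi.add_apply, Pi.smul_apply, smul_eq_mul, Finset.sum_add_distrib,
      ← Finset.mul_sum]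
    nlinarith [hx.2, hy.2]

theorem isClosed_corner (m : ℕ) : IsClosed (corner m) := by
  have : corner m = (⋂ j, {u | 0 ≤ u j}) ∩ {u | ∑ j, u j ≤ 1} := by
    ext; simp [corner]
  rw [this]
  exact (isClosed_iInter fun j => isClosed_le (by fun_prop) (by fun_prop)).inter
    (isClosed_le (by fun_prop) (by fun_prop))

theorem uniqueDiffOn_corner (m : ℕ) : UniqueDiffOn ℝ (corner m) := by
  -- The barycenter is an interior point: its `m` coordinates sum to `m / (m + 1) < 1`.
  refine uniqueDiffOn_convex (convex_corner m) ⟨fun _ => 1 / (m + 1 : ℝ), ?_⟩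
  have hm : (0 : ℝ) < m + 1 := by positivity
  refine mem_interior.2 ⟨(⋂ j, {u | 0 < u j}) ∩ {u | ∑ j, u j < 1}, ?_, ?_, ?_⟩
  · rintro u ⟨h1, h2⟩
    exact ⟨fun j => (Set.mem_iInter.1 h1 j : 0 < u j).le, le_of_lt h2⟩
  · exact (isOpen_iInter_of_finite fun j => isOpen_lt (by fun_prop) (by fun_prop)).inter
      (isOpen_lt (by fun_prop) (by fun_prop))
  · refine ⟨Set.mem_iInter.2 fun j => show (0 : ℝ) < 1 / (m + 1 : ℝ) by positivity, ?_⟩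
    simp only [Set.mem_ofPred_eq, Finset.sum_const, Finset.card_univ, Fintype.card_fin,
      nsmul_eq_mul]
    rw [mul_one_div, div_lt_one hm]
    linarith

theorem barycentric_mem {m : ℕ} {u : Fin m → ℝ} (hu : u ∈ corner m) :
    barycentric u ∈ stdSimplex ℝ (Fin (m + 1)) := by
  rw [← coe_simplexPoint hu]
  exact (simplexPoint u).2

/-- The linear part of the affine map `u ↦ (g_i t_i)`, `t` the barycentric coordinates of `u`. -/
theorem fderiv_twist_barycentric {m : ℕ} (g : Fin (m + 1) → ℂ) (u : Fin m → ℝ) (a : Fin m) :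
    fderiv ℝ (fun u : Fin m → ℝ => twist g (barycentric u)) u (Pi.single a 1) =
      twist g (edge a) := by
  have hdiff : Differentiable ℝ fun u : Fin m → ℝ => twist g (barycentric u) :=
    (contDiff_twist_barycentric g).differentiable (by simp)
  have h1 := (hdiff u).hasFDerivAt.hasLineDerivAt (Pi.single a 1)
  have h2 : HasLineDerivAt ℝ (fun u : Fin m → ℝ => twist g (barycentric u))
      (twist g (edge a)) u (Pi.single a 1) := by
    have key : ∀ t : ℝ, twist g (barycentric (u + t • Pi.single a 1)) =
        twist g (barycentric u) + t • twist g (edge a) := by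
      intro t
      ext i
      refine Fin.cases ?_ (fun j => ?_) i
      · simp [twist, barycentric, edge, Finset.sum_add_distrib, ← Finset.mul_sum]
        ring
      · simp [twist, barycentric, edge]
        ring
    simp only [HasLineDerivAt, key]
    simpa using ((hasDerivAt_id (0 : ℝ)).smul_const (twist g (edge a))).const_add
      (twist g (barycentric u))
  exact h1.unique h2

/-- Product rule: the derivative of the normalizing factor only contributes along `V u`, a direction
that `Ω` at `V u` ignores. -/
theorem fderivWithin_inv_smul {m : ℕ} {V : (Fin m → ℝ) → Fin (m + 1) → ℂ} {u : Fin m → ℝ}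
    (hV : DifferentiableAt ℝ V u) (hu : u ∈ corner m) (i : Fin (m + 1)) (hi : V u i ≠ 0)
    (e : Fin m → ℝ) :
    ∃ b : ℂ, fderivWithin ℝ (fun u' => (V u' i)⁻¹ • V u') (corner m) u e =
      (V u i)⁻¹ • fderiv ℝ V u e + b • V u := by
  have hVi : DifferentiableAt ℝ (fun u' => V u' i) u := differentiableAt_pi.1 hV i
  have hinv : DifferentiableAt ℝ (fun u' => (V u' i)⁻¹) u := hVi.inv hi
  refine ⟨fderiv ℝ (fun u' => (V u' i)⁻¹) u e, ?_⟩
  rw [fderivWithin_eq_fderiv (uniqueDiffOn_corner m u hu) (hinv.fun_smul hV), fderiv_fun_smul hinv hV]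
  simp

theorem integrand_twistedSimplex {m d r : ℕ} (hd : 0 < d) {c : Fin (m + 1) → ℕ}
    (hc : ∀ i, 0 < c i) (hr : ∑ i, c i = d * r) (g : Fin (m + 1) → ℂ) (hg : ∀ i, g i ^ d = 1)
    {u : Fin m → ℝ} (hu : u ∈ corner m) (i : Fin (m + 1))
    (hi : ((twistedSimplex hd g hg).eval u).rep i ≠ 0) :
    fermatForm m d c r (normalized i ((twistedSimplex hd g hg).eval u)) (fun a =>
      fderivWithin ℝ (fun u' => normalized i ((twistedSimplex hd g hg).eval u'))
        (corner m) u (Pi.single a 1)) =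
      -(∏ i, g i ^ c i) * (((∏ i, barycentric u i ^ (c i - 1)) /
        (∑ i, barycentric u i ^ d) ^ r : ℝ) : ℂ) := by
  rw [rep_eval_twistedSimplex_ne_zero_iff hd g hg i hu] at hi
  have hcongr : ∀ a : Fin m, fderivWithin ℝ
      (fun u' => normalized i ((twistedSimplex hd g hg).eval u')) (corner m) u (Pi.single a 1) =
      fderivWithin ℝ (fun u' => (twist g (barycentric u') i)⁻¹ • twist g (barycentric u'))
        (corner m) u (Pi.single a 1) := fun a => by
    rw [fderivWithin_congr' (fun u' hu' => normalized_eval_twistedSimplex hd g hg i hu') hu]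
  choose b hb using fun a : Fin m => fderivWithin_inv_smul
    (((contDiff_twist_barycentric g).differentiable (by simp)) u) hu i hi (Pi.single a 1)
  simp only [hcongr, hb, normalized_eval_twistedSimplex hd g hg i hu, fderiv_twist_barycentric]
  -- The chart drops out here: what remains is the form at the unnormalized lift `g t`, on the
  -- vectors `g * edge a`.
  rw [fermatForm_smul_add hc hr _ (inv_ne_zero hi)]
  simp only [twist]
  rw [fermatForm_mul hc hg, fermatForm, AlternatingMap.smul_apply, eulerForm_edge]
  have hsum : ∑ i, ((barycentric u i : ℝ) : ℂ) = 1 := by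
    exact_mod_cast congrArg (Complex.ofReal) (sum_barycentric u)
  rw [hsum, fermat]
  push_cast
  simp

theorem integral_twistedSimplex {m d r : ℕ} (hd : 0 < d) {c : Fin (m + 1) → ℕ}
    (hc : ∀ i, 0 < c i) (hr : ∑ i, c i = d * r) (g : Fin (m + 1) → ℂ) (hg : ∀ i, g i ^ d = 1) :
    SmoothSimplex.integral ⟨twistedSimplex hd g hg, isSmooth_twistedSimplex hd g hg⟩
      (fermatForm m d c r) =
      -(∏ i, g i ^ c i) * ((∫ u in corner m, (∏ i, barycentric u i ^ (c i - 1)) /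
        (∑ i, barycentric u i ^ d) ^ r : ℝ) : ℂ) := by
  rw [SmoothSimplex.integral, ← integral_complex_ofReal, ← MeasureTheory.integral_const_mul]
  refine MeasureTheory.setIntegral_congr_fun (isClosed_corner m).measurableSet fun u hu => ?_
  exact integrand_twistedSimplex hd hc hr g hg hu _ (exists_rep_ne_zero _).choose_spec

/-! ### The Dirichlet integral -/

section

open MeasureTheory

/-- Stated for the lower integral so that the later interchanges are instances of Tonelli and need
no integrability. -/
theorem lintegral_pow_mul_exp {d k : ℕ} (hd : 0 < d) (hk : 0 < k) {b : ℝ} (hb : 0 < b) :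
    ∫⁻ x in Set.Ioi (0 : ℝ), ENNReal.ofReal (x ^ (k - 1) * Real.exp (-b * x ^ d)) =
      ENNReal.ofReal (b ^ (-((k : ℝ) / d)) * (1 / d) * Real.Gamma (k / d)) := by
  have hd' : (0 : ℝ) < d := by exact_mod_cast hd
  have hk' : (0 : ℝ) < k := by exact_mod_cast hk
  have hcast : ((k - 1 : ℕ) : ℝ) = k - 1 := by rw [Nat.cast_sub hk, Nat.cast_one]
  have h := integral_rpow_mul_exp_neg_mul_rpow (p := (d : ℝ)) (q := ((k - 1 : ℕ) : ℝ)) (b := b)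
    hd' (by rw [hcast]; linarith) hb
  simp only [Real.rpow_natCast] at h
  rw [hcast, sub_add_cancel, neg_div] at h
  rw [← h, ofReal_integral_eq_lintegral_ofReal]
  · refine not_imp_comm.1 integral_undef ?_
    rw [h]
    have := Real.Gamma_pos_of_pos (div_pos hk' hd')
    positivity
  · filter_upwards [ae_restrict_mem measurableSet_Ioi] with x hx
    have : (0 : ℝ) < x := hx
    positivity

theorem lintegral_fin_succ {m : ℕ} {G : (Fin (m + 1) → ℝ) → ENNReal} (hG : Measurable G) :
    ∫⁻ y, G y = ∫⁻ v : Fin m → ℝ, ∫⁻ x : ℝ, G (Fin.cons x v) := by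
  have e := volume_preserving_piFinSuccAbove (fun _ : Fin (m + 1) => ℝ) 0
  rw [← e.symm.lintegral_comp hG, Measure.volume_eq_prod, lintegral_prod_symm]
  · simp [MeasurableEquiv.piFinSuccAbove, Fin.insertNthEquiv]
  · exact (hG.comp (MeasurableEquiv.measurable _)).aemeasurable

theorem lintegral_comp_smul {m : ℕ} {t : ℝ} (ht : 0 < t) {H : (Fin m → ℝ) → ENNReal}
    (hH : Measurable H) :
    ∫⁻ v, H v = ENNReal.ofReal (t ^ m) * ∫⁻ u, H (t • u) := by
  have h := Measure.map_addHaar_smul (volume : Measure (Fin m → ℝ)) ht.ne'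
  rw [Module.finrank_fin_fun] at h
  rw [← lintegral_map (f := H) hH (measurable_const_smul t), h, lintegral_smul_measure,
    smul_eq_mul, ← mul_assoc, ← ENNReal.ofReal_mul (by positivity), abs_of_pos (by positivity),
    mul_inv_cancel₀ (by positivity), ENNReal.ofReal_one, one_mul]

theorem measurable_barycentric (m : ℕ) : Measurable (barycentric (m := m)) := by
  rw [measurable_pi_iff]
  intro i
  refine Fin.cases ?_ (fun j => ?_) i
  · change Measurable fun u : Fin m → ℝ => 1 - ∑ j, u j
    fun_prop
  · change Measurable fun u : Fin m → ℝ => u j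
    fun_prop

theorem mem_corner_of_barycentric_nonneg {m : ℕ} {u : Fin m → ℝ}
    (h : ∀ i, 0 ≤ barycentric u i) : u ∈ corner m :=
  ⟨fun j => by simpa [barycentric] using h j.succ, by simpa [barycentric] using h 0⟩

/-- Integration over the orthant in the coordinates `y = s t`, `s > 0` and `t` in the simplex. -/
theorem lintegral_orthant {m : ℕ} {G : (Fin (m + 1) → ℝ) → ENNReal} (hG : Measurable G)
    (hG0 : ∀ y, (∃ i, y i < 0) → G y = 0) :
    ∫⁻ y, G y = ∫⁻ u in corner m, ∫⁻ s in Set.Ioi (0 : ℝ),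
      ENNReal.ofReal (s ^ m) * G (s • barycentric u) := by
  have hcons : Measurable fun p : ℝ × (Fin m → ℝ) =>
      (Fin.cons (p.1 - ∑ j, p.2 j) p.2 : Fin (m + 1) → ℝ) := by
    rw [measurable_pi_iff]
    intro i
    refine Fin.cases ?_ (fun j => ?_) i
    · change Measurable fun p : ℝ × (Fin m → ℝ) => p.1 - ∑ j, p.2 j
      fun_prop
    · change Measurable fun p : ℝ × (Fin m → ℝ) => p.2 j
      fun_prop
  have hmeas : Measurable fun p : ℝ × (Fin m → ℝ) => G (p.1 • barycentric p.2) :=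
    hG.comp (measurable_fst.smul ((measurable_barycentric m).comp measurable_snd))
  -- The slice of the orthant by `∑ y_i = t` is the simplex scaled by `t`, with Jacobian `t ^ m`.
  have hslice : ∀ t : ℝ, 0 < t → ∫⁻ v : Fin m → ℝ, G (Fin.cons (t - ∑ j, v j) v) =
      ∫⁻ u in corner m, ENNReal.ofReal (t ^ m) * G (t • barycentric u) := by
    intro t ht
    rw [lintegral_comp_smul ht (H := fun v => G (Fin.cons (t - ∑ j, v j) v))
      (hG.comp (hcons.comp measurable_prodMk_left)),
      ← lintegral_const_mul' _ _ ENNReal.ofReal_ne_top, ← lintegral_indicator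
      (isClosed_corner m).measurableSet]
    refine lintegral_congr fun u => ?_
    have hb : (Fin.cons (t - ∑ j, (t • u) j) (t • u) : Fin (m + 1) → ℝ) = t • barycentric u := by
      ext i
      refine Fin.cases ?_ (fun j => ?_) i
      · simp [barycentric, ← Finset.mul_sum, mul_sub]
      · simp [barycentric]
    by_cases hu : u ∈ corner m
    · simp only [Set.indicator_of_mem hu, hb]
    · have : G (t • barycentric u) = 0 := by
        refine hG0 _ ?_
        by_contra! h
        refine hu (mem_corner_of_barycentric_nonneg fun i => ?_)
        exact nonneg_of_mul_nonneg_right (h i) ht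
      simp only [Set.indicator_of_notMem hu, hb, this, mul_zero]
  calc ∫⁻ y, G y = ∫⁻ v : Fin m → ℝ, ∫⁻ x : ℝ, G (Fin.cons x v) := lintegral_fin_succ hG
    -- A translation in the first coordinate makes the sum `t` of all coordinates the variable.
    _ = ∫⁻ v : Fin m → ℝ, ∫⁻ t : ℝ, G (Fin.cons (t - ∑ j, v j) v) :=
        lintegral_congr fun v =>
          (lintegral_sub_right_eq_self (fun x => G (Fin.cons x v)) (∑ j, v j)).symm
    _ = ∫⁻ t : ℝ, ∫⁻ v : Fin m → ℝ, G (Fin.cons (t - ∑ j, v j) v) :=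
        lintegral_lintegral_swap ((hG.comp hcons).comp measurable_swap).aemeasurable
    _ = ∫⁻ t in Set.Ici (0 : ℝ), ∫⁻ v : Fin m → ℝ, G (Fin.cons (t - ∑ j, v j) v) := by
        rw [← lintegral_indicator measurableSet_Ici]
        refine lintegral_congr fun t => ?_
        by_cases ht : t ∈ Set.Ici (0 : ℝ)
        · rw [Set.indicator_of_mem ht]
        · rw [Set.indicator_of_notMem ht]
          refine (lintegral_congr fun v => hG0 _ ?_).trans lintegral_zero
          by_contra! h
          have h0 := h 0
          have h1 : 0 ≤ ∑ j, v j := Finset.sum_nonneg fun j _ => by simpa using h j.succ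
          simp only [Fin.cons_zero] at h0
          exact ht (show (0 : ℝ) ≤ t by linarith)
    _ = ∫⁻ t in Set.Ioi (0 : ℝ), ∫⁻ v : Fin m → ℝ, G (Fin.cons (t - ∑ j, v j) v) :=
        (setLIntegral_congr Ioi_ae_eq_Ici).symm
    _ = ∫⁻ s in Set.Ioi (0 : ℝ), ∫⁻ u in corner m,
          ENNReal.ofReal (s ^ m) * G (s • barycentric u) :=
        setLIntegral_congr_fun measurableSet_Ioi fun t ht => hslice t ht
    _ = _ := by
        refine lintegral_lintegral_swap (Measurable.aemeasurable ?_)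
        exact (measurable_fst.pow_const m).ennreal_ofReal.mul hmeas

/-- The product side of the double computation. The indicators make the integrand vanish off the
orthant, as `lintegral_orthant` requires. -/
theorem lintegral_orthant_prod {m d : ℕ} (hd : 0 < d) {c : Fin (m + 1) → ℕ}
    (hc : ∀ i, 0 < c i) :
    ∫⁻ y : Fin (m + 1) → ℝ, ENNReal.ofReal (∏ i, (Set.Ici (0 : ℝ)).indicator
      (fun x => x ^ (c i - 1) * Real.exp (-1 * x ^ d)) (y i)) =
      ENNReal.ofReal (∏ i, (1 / d * Real.Gamma (c i / d))) := by
  have hd' : (0 : ℝ) < d := by exact_mod_cast hd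
  have hpos : ∀ i, 0 < Real.Gamma ((c i : ℝ) / d) := fun i =>
    Real.Gamma_pos_of_pos (div_pos (by exact_mod_cast hc i) hd')
  have h1 : ∀ i, ∫ x, (Set.Ici (0 : ℝ)).indicator
      (fun x => x ^ (c i - 1) * Real.exp (-1 * x ^ d)) x = 1 / d * Real.Gamma (c i / d) := by
    intro i
    rw [integral_indicator measurableSet_Ici, integral_Ici_eq_integral_Ioi,
      integral_eq_lintegral_of_nonneg_ae, lintegral_pow_mul_exp hd (hc i) one_pos,
      Real.one_rpow, one_mul, ENNReal.toReal_ofReal]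
    · exact (mul_pos (by positivity) (hpos i)).le
    · filter_upwards [ae_restrict_mem measurableSet_Ioi] with x hx
      have : (0 : ℝ) < x := hx
      simp only [Pi.zero_apply]
      positivity
    · exact Continuous.aestronglyMeasurable (by fun_prop)
  have h2 := integral_fintype_prod_volume_eq_prod (𝕜 := ℝ) (fun (i : Fin (m + 1)) (x : ℝ) =>
    (Set.Ici (0 : ℝ)).indicator (fun x => x ^ (c i - 1) * Real.exp (-1 * x ^ d)) x)
  simp only [h1] at h2
  rw [← h2, ofReal_integral_eq_lintegral_ofReal]
  · refine not_imp_comm.1 integral_undef ?_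
    rw [h2]
    exact (Finset.prod_pos fun i _ => mul_pos (by positivity) (hpos i)).ne'
  · refine Filter.Eventually.of_forall fun y => Finset.prod_nonneg fun i _ =>
      Set.indicator_nonneg (fun x hx => ?_) _
    have : (0 : ℝ) ≤ x := hx
    positivity

/-- The integral of a monomial over a power of `F_d` on the simplex. -/
theorem integral_corner {m d r : ℕ} (hd : 0 < d) {c : Fin (m + 1) → ℕ}
    (hc : ∀ i, 0 < c i) (hr : ∑ i, c i = d * r) :
    ∫ u in corner m, (∏ i, barycentric u i ^ (c i - 1)) / (∑ i, barycentric u i ^ d) ^ r =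
      (∏ i, Real.Gamma (c i / d)) / (d ^ m * Real.Gamma r) := by
  have hd' : (0 : ℝ) < d := by exact_mod_cast hd
  have hk : 0 < d * r := hr ▸ Finset.sum_pos (fun i _ => hc i) Finset.univ_nonempty
  have hr' : (0 : ℝ) < r := by exact_mod_cast Nat.pos_of_mul_pos_left hk
  have hΓr := Real.Gamma_pos_of_pos hr'
  have hpos : ∀ i, 0 < Real.Gamma ((c i : ℝ) / d) := fun i =>
    Real.Gamma_pos_of_pos (div_pos (by exact_mod_cast hc i) hd')
  set h : (Fin m → ℝ) → ℝ := fun u =>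
    (∏ i, barycentric u i ^ (c i - 1)) / (∑ i, barycentric u i ^ d) ^ r with hh
  have hb : ∀ i, Measurable fun u : Fin m → ℝ => barycentric u i :=
    fun i => (measurable_pi_apply i).comp (measurable_barycentric m)
  have hmeas : Measurable h :=
    (Finset.measurable_prod _ fun i _ => (hb i).pow_const _).div
      ((Finset.measurable_sum _ fun i _ => (hb i).pow_const _).pow_const _)
  have hnonneg : ∀ u ∈ corner m, 0 ≤ h u := fun u hu =>
    div_nonneg (Finset.prod_nonneg fun i _ => pow_nonneg ((barycentric_mem hu).1 i) _)
      (pow_nonneg (sum_pow_pos d (barycentric_mem hu)).le _)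
  set f : Fin (m + 1) → ℝ → ℝ := fun i => (Set.Ici (0 : ℝ)).indicator
      (fun x => x ^ (c i - 1) * Real.exp (-1 * x ^ d)) with hf
  have hfm : ∀ i, Measurable (f i) := fun i =>
    Measurable.indicator (by fun_prop) measurableSet_Ici
  have key := lintegral_orthant (m := m)
    (G := fun y => ENNReal.ofReal (∏ i, f i (y i)))
    (Finset.measurable_prod _ fun i _ => (hfm i).comp (measurable_pi_apply i)).ennreal_ofReal
    (by
      rintro y ⟨i, hi⟩
      rw [Finset.prod_eq_zero (Finset.mem_univ i), ENNReal.ofReal_zero]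
      exact Set.indicator_of_notMem (by simpa using hi) _)
  rw [lintegral_orthant_prod hd hc] at key
  -- The radial side: `s ^ m` and the monomial combine to `s ^ (d r - 1)`, and the Gamma integral
  -- with `b = ∑ t_i ^ d` produces `Γ(r) / (d b ^ r)`.
  have inner : ∀ u ∈ corner m, ∫⁻ s in Set.Ioi (0 : ℝ), ENNReal.ofReal (s ^ m) *
      ENNReal.ofReal (∏ i, f i ((s • barycentric u) i)) =
      ENNReal.ofReal (1 / d * Real.Gamma r) * ENNReal.ofReal (h u) := by
    intro u hu
    have hu' := barycentric_mem hu
    have hF := sum_pow_pos d hu'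
    have hP : 0 ≤ ∏ i, barycentric u i ^ (c i - 1) :=
      Finset.prod_nonneg fun i _ => pow_nonneg (hu'.1 i) _
    have hpt : ∀ s ∈ Set.Ioi (0 : ℝ), ENNReal.ofReal (s ^ m) *
        ENNReal.ofReal (∏ i, f i ((s • barycentric u) i)) =
        ENNReal.ofReal (∏ i, barycentric u i ^ (c i - 1)) * ENNReal.ofReal
          (s ^ (d * r - 1) * Real.exp (-(∑ i, barycentric u i ^ d) * s ^ d)) := by
      intro s hs
      have hs' : (0 : ℝ) < s := hs
      rw [← ENNReal.ofReal_mul (by positivity), ← ENNReal.ofReal_mul hP]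
      congr 1
      have hfi : ∀ i, f i ((s • barycentric u) i) = s ^ (c i - 1) *
          barycentric u i ^ (c i - 1) * Real.exp (-(barycentric u i ^ d * s ^ d)) := by
        intro i
        have hmem : (s • barycentric u) i ∈ Set.Ici (0 : ℝ) :=
          mul_nonneg hs'.le (hu'.1 i)
        refine (Set.indicator_of_mem hmem _).trans ?_
        simp only [Pi.smul_apply, smul_eq_mul, mul_pow, neg_one_mul, mul_comm (s ^ d)]
      have hexp : m + ∑ i, (c i - 1) = d * r - 1 := by
        have := sum_sub_one_add hc
        omega
      rw [Finset.prod_congr rfl fun i _ => hfi i, Finset.prod_mul_distrib,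
        Finset.prod_mul_distrib, Finset.prod_pow_eq_pow_sum, ← Real.exp_sum, ← hexp, pow_add,
        Finset.sum_neg_distrib, ← Finset.sum_mul, neg_mul]
      ring
    rw [setLIntegral_congr_fun measurableSet_Ioi hpt,
      lintegral_const_mul' _ _ ENNReal.ofReal_ne_top, lintegral_pow_mul_exp hd hk hF,
      ← ENNReal.ofReal_mul hP, ← ENNReal.ofReal_mul (by positivity)]
    congr 1
    have : ((d * r : ℕ) : ℝ) / d = r := by
      push_cast
      field_simp
    rw [this, Real.rpow_neg hF.le, Real.rpow_natCast, hh]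
    simp only
    ring
  rw [setLIntegral_congr_fun (isClosed_corner m).measurableSet inner,
    lintegral_const_mul' _ _ ENNReal.ofReal_ne_top] at key
  rw [integral_eq_lintegral_of_nonneg_ae
    ((ae_restrict_mem (isClosed_corner m).measurableSet).mono hnonneg)
    hmeas.aestronglyMeasurable]
  have key' := congrArg ENNReal.toReal key
  rw [ENNReal.toReal_mul, ENNReal.toReal_ofReal (Finset.prod_nonneg fun i _ =>
    (mul_pos (by positivity) (hpos i)).le), ENNReal.toReal_ofReal (by positivity),
    Finset.prod_mul_distrib, Finset.prod_const, Finset.card_univ, Fintype.card_fin] at key'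
  rw [eq_div_iff (by positivity)]
  have hdd : ((d : ℝ) ^ (m + 1)) * ((1 / (d : ℝ)) ^ (m + 1)) = 1 := by
    rw [← mul_pow, mul_one_div_cancel hd'.ne', one_pow]
  calc _ = (d : ℝ) ^ (m + 1) * (1 / d * Real.Gamma r *
        (∫⁻ u in corner m, ENNReal.ofReal (h u)).toReal) := by
        rw [pow_succ]; field_simp
    _ = _ := by rw [← key', ← mul_assoc, hdd, one_mul]

end

/-! ### The cycle -/

open CategoryTheory

/-- The element `x` is viewed as the morphism `ℚ ⟶ K.X n` sending 1 to `x`; it lifts by the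
universal property of the cycles. -/
theorem exists_cycles_eq (K : ChainComplex (ModuleCat.{0} ℚ) ℕ) {n : ℕ} (x : K.X n)
    (hx : (K.d n ((ComplexShape.down ℕ).next n)).hom x = 0) :
    ∃ w : K.cycles n, (K.iCycles n).hom w = x := by
  set k : ModuleCat.of ℚ ℚ ⟶ K.X n := ModuleCat.ofHom (LinearMap.toSpanSingleton ℚ _ x) with hk
  have hk0 : k ≫ K.d n ((ComplexShape.down ℕ).next n) = 0 := by
    ext
    simp [hk, hx]
  refine ⟨(K.liftCycles k _ rfl hk0).hom (1 : ℚ), ?_⟩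
  have h := congrArg (fun f => f.hom (1 : ℚ)) (K.liftCycles_i k _ rfl hk0)
  simp only [ModuleCat.hom_comp, LinearMap.comp_apply] at h
  rw [h, hk]
  simp

theorem SmoothChain.exists_represents {m d : ℕ} (z : SmoothChain m d)
    (hz : ((chains m d).d m ((ComplexShape.down ℕ).next m)).hom z.toChain = 0) :
    ∃ δ : BettiHomology m d m, z.Represents δ :=
  let ⟨w, hw⟩ := exists_cycles_eq (chains m d) z.toChain hz
  ⟨_, w, hw, rfl⟩

theorem d_ιChainComplex_apply (X : SSet.{0}) {n : ℕ} (x : X _⦋n + 1⦌) (a : ℚ) :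
    ((X.chainComplex (ModuleCat.of ℚ ℚ)).d (n + 1) n).hom
        ((X.ιChainComplex (R := ModuleCat.of ℚ ℚ) x).hom a) =
      ∑ i : Fin (n + 2), (-1 : ℤ) ^ (i : ℕ) •
        (X.ιChainComplex (R := ModuleCat.of ℚ ℚ) (X.δ i x)).hom a := by
  have h := congrArg (fun f => f.hom a) (SSet.ιChainComplex_d (R := ModuleCat.of ℚ ℚ) X x)
  simpa only [ModuleCat.hom_comp, LinearMap.comp_apply, ModuleCat.hom_sum, LinearMap.sum_apply,
    ModuleCat.hom_zsmul, LinearMap.smul_apply] using h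

/-- A family of simplices indexed by the sets of vertices, in which toggling a vertex preserves the
face opposite to it and changes the sign of the coefficient, is a cycle. -/
theorem d_sum_eq_zero (X : SSet.{0}) {n : ℕ} (σ : Finset (Fin (n + 2)) → X _⦋n + 1⦌)
    (a : Finset (Fin (n + 2)) → ℚ) (hσ : ∀ S i, X.δ i (σ (symmDiff S {i})) = X.δ i (σ S))
    (ha : ∀ S i, a (symmDiff S {i}) = -a S) :
    ((X.chainComplex (ModuleCat.of ℚ ℚ)).d (n + 1) n).hom
      (∑ S, (X.ιChainComplex (R := ModuleCat.of ℚ ℚ) (σ S)).hom (a S)) = 0 := by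
  rw [map_sum, Finset.sum_congr rfl fun S _ => d_ιChainComplex_apply X (σ S) (a S),
    Finset.sum_comm]
  refine Finset.sum_eq_zero fun i _ => ?_
  -- For a fixed face index `i`, toggling `i` is a fixed-point-free involution pairing opposite
  -- terms.
  refine Finset.sum_involution (fun S _ => symmDiff S {i}) ?_ ?_ ?_ ?_
  · intro S _
    rw [hσ, ha, map_neg, smul_neg, add_neg_cancel]
  · intro S _ _ hS
    have := congrArg (i ∈ ·) hS
    simp [Finset.mem_symmDiff] at this
  · intro S _
    exact Finset.mem_univ _
  · intro S _
    simp

/-- The tuple with entries `ζ` on `S` and `1` elsewhere. -/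
def rootTuple {m : ℕ} (ζ : ℂ) (S : Finset (Fin (m + 1))) : Fin (m + 1) → ℂ :=
  fun i => if i ∈ S then ζ else 1

theorem rootTuple_pow {m d : ℕ} {ζ : ℂ} (hζ : ζ ^ d = 1) (S : Finset (Fin (m + 1)))
    (i : Fin (m + 1)) : rootTuple ζ S i ^ d = 1 := by
  unfold rootTuple
  split_ifs <;> simp [hζ]

section

variable {m d : ℕ} (hd : 0 < d) {ζ : ℂ} (hζ : ζ ^ d = 1)

/-- The smooth simplex `t ↦ [g_1 t_1 : ... : g_n t_n]` with `g_i = ζ` for `i ∈ S` and `g_i = 1`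
otherwise. -/
def joinSimplex (S : Finset (Fin (m + 1))) : SmoothSimplex m d :=
  ⟨twistedSimplex hd (rootTuple ζ S) (rootTuple_pow hζ S), isSmooth_twistedSimplex _ _ _⟩

/-- The coefficients of the expansion of `-d ^ m ∏ (T_i - 1)`. -/
def joinCoeff (m d : ℕ) (S : Finset (Fin (m + 1))) : ℚ := -(d ^ m * (-1) ^ Sᶜ.card)

/-- The join of the `m + 1` zero-cycles `[ζ] - [1]`, multiplied by `-d ^ m`. -/
def joinCycle : SmoothChain m d :=
  ∑ S : Finset (Fin (m + 1)), Finsupp.single (joinSimplex hd hζ S) (joinCoeff m d S)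

/-- Additivity of `h` replaces injectivity of `S ↦ joinSimplex hd hζ S`, which can fail: for `d = 1`
all these simplices coincide. -/
theorem joinCycle_sum {M : Type*} [AddCommMonoid M] (h : SmoothSimplex m d → ℚ → M)
    (h0 : ∀ σ, h σ 0 = 0) (hadd : ∀ σ a b, h σ (a + b) = h σ a + h σ b) :
    (joinCycle hd hζ).sum h = ∑ S, h (joinSimplex hd hζ S) (joinCoeff m d S) := by
  rw [joinCycle, ← Finsupp.sum_finsetSum_index h0 hadd]
  exact Finset.sum_congr rfl fun S _ => Finsupp.sum_single_index (h0 _)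

theorem toChain_joinCycle : (joinCycle hd hζ).toChain = ∑ S,
    ((TopCat.toSSet.obj (TopCat.of (FermatComplement m d))).ιChainComplex
      (R := ModuleCat.of ℚ ℚ) (joinSimplex hd hζ S).1).hom (joinCoeff m d S) :=
  joinCycle_sum hd hζ _ (fun _ => map_zero _) fun _ => map_add _

theorem integral_joinCycle (η : (Fin (m + 1) → ℂ) → (Fin (m + 1) → ℂ) [⋀^Fin m]→ₗ[ℂ] ℂ) :
    (joinCycle hd hζ).integral η =
      ∑ S, (joinCoeff m d S : ℂ) * SmoothSimplex.integral (joinSimplex hd hζ S) η :=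
  joinCycle_sum hd hζ _ (fun _ => by simp) fun _ _ _ => by push_cast; ring

end

theorem card_compl_symmDiff_singleton {m : ℕ} (S : Finset (Fin (m + 1))) (i : Fin (m + 1)) :
    (-1 : ℚ) ^ (symmDiff S {i})ᶜ.card = -(-1) ^ Sᶜ.card := by
  by_cases hi : i ∈ S
  · have h : (symmDiff S {i})ᶜ = insert i Sᶜ := by
      ext j
      by_cases hj : j = i <;> simp [hj, hi]
    rw [h, Finset.card_insert_of_notMem (by simpa using hi), pow_succ, mul_neg_one]
  · have h : Sᶜ = insert i (symmDiff S {i})ᶜ := by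
      ext j
      by_cases hj : j = i <;> simp [hj, hi]
    rw [h, Finset.card_insert_of_notMem (by simp [hi]), pow_succ,
      mul_neg_one, neg_neg]

theorem joinCoeff_symmDiff_singleton {m : ℕ} (d : ℕ) (S : Finset (Fin (m + 1)))
    (i : Fin (m + 1)) : joinCoeff m d (symmDiff S {i}) = -joinCoeff m d S := by
  rw [joinCoeff, joinCoeff, card_compl_symmDiff_singleton, mul_neg]

theorem twistedMap_congr {m d : ℕ} (hd : 0 < d) {g g' : Fin (m + 1) → ℂ}
    (hg : ∀ i, g i ^ d = 1) (hg' : ∀ i, g' i ^ d = 1) (t : stdSimplex ℝ (Fin (m + 1)))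
    (h : twist g t = twist g' t) : twistedMap hd g hg t = twistedMap hd g' hg' t := by
  refine Subtype.ext ?_
  simp only [twistedMap, ContinuousMap.coe_mk, h]

/-- The `i`-th face of the simplex `t ↦ [g_1 t_1 : ... : g_n t_n]` does not depend on `g_i`. -/
theorem face_twistedSimplex {m d : ℕ} (hd : 0 < d) {g g' : Fin (m + 2) → ℂ}
    (hg : ∀ i, g i ^ d = 1) (hg' : ∀ i, g' i ^ d = 1) (i : Fin (m + 2))
    (h : ∀ j ≠ i, g j = g' j) :
    (TopCat.toSSet.obj (TopCat.of (FermatComplement (m + 1) d))).δ i (twistedSimplex hd g hg) =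
      (TopCat.toSSet.obj (TopCat.of (FermatComplement (m + 1) d))).δ i
        (twistedSimplex hd g' hg') := by
  have hmap : (twistedMap hd g hg).comp ⟨stdSimplex.map i.succAbove, stdSimplex.continuous_map _⟩ =
      (twistedMap hd g' hg').comp ⟨stdSimplex.map i.succAbove, stdSimplex.continuous_map _⟩ := by
    refine ContinuousMap.ext fun t => twistedMap_congr hd hg hg' _ (funext fun j => ?_)
    simp only [twist, Pi.mul_apply, ContinuousMap.coe_mk]
    by_cases hj : j = i
    · have h0 : (stdSimplex.map i.succAbove t : Fin (m + 2) → ℝ) j = 0 := by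
        rw [stdSimplex.map_coe, FunOnFinite.linearMap_apply_apply]
        refine Finset.sum_eq_zero fun k hk => ?_
        exact absurd ((Finset.mem_filter.1 hk).2.trans hj) (Fin.succAbove_ne i k)
      rw [h0, Complex.ofReal_zero, mul_zero, mul_zero]
    · rw [h j hj]
  -- Taking the `i`-th face is, by definition, precomposition with the coface map.
  exact congrArg (TopCat.toSSetObjEquiv (TopCat.of (FermatComplement (m + 1) d)) (.op ⦋m⦌)).symm
    hmap

theorem d_toChain_joinCycle {m d : ℕ} (hd : 0 < d) {ζ : ℂ} (hζ : ζ ^ d = 1) :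
    ((chains m d).d m ((ComplexShape.down ℕ).next m)).hom (joinCycle hd hζ).toChain = 0 := by
  cases m with
  | zero => rw [(chains 0 d).shape _ _ (by simp)]; rfl
  | succ k =>
    rw [ChainComplex.next_nat_succ, toChain_joinCycle]
    refine d_sum_eq_zero (TopCat.toSSet.obj (TopCat.of (FermatComplement (k + 1) d))) _ _
      (fun S i => face_twistedSimplex hd _ _ i fun j hj => ?_)
      fun S i => joinCoeff_symmDiff_singleton d S i
    simp [rootTuple, Finset.mem_symmDiff, hj]

/-! ### The period -/

theorem sum_joinCoeff {m : ℕ} (d : ℕ) (ζ : ℂ) (c : Fin (m + 1) → ℕ) :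
    ∑ S, (joinCoeff m d S : ℂ) * ∏ i, rootTuple ζ S i ^ c i =
      -(d ^ m * ∏ i, (ζ ^ c i - 1)) := by
  have h : ∏ i, (ζ ^ c i - 1) = ∑ S : Finset (Fin (m + 1)),
      (-1) ^ Sᶜ.card * ∏ i, rootTuple ζ S i ^ c i := by
    simp only [sub_eq_add_neg]
    rw [Finset.prod_add, Finset.powerset_univ]
    refine Finset.sum_congr rfl fun S _ => ?_
    rw [Finset.prod_const, ← Finset.compl_eq_univ_sdiff, mul_comm]
    congr 1
    rw [← Finset.prod_subset (Finset.subset_univ S)]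
    · exact Finset.prod_congr rfl fun i hi => by simp [rootTuple, hi]
    · intro i _ hi
      simp [rootTuple, hi]
  rw [h, Finset.mul_sum, ← Finset.sum_neg_distrib]
  refine Finset.sum_congr rfl fun S _ => ?_
  simp only [joinCoeff]
  push_cast
  ring

open Complex in
-- Reflection formula combined with `exp (2πis) - 1 = 2i exp (πis) sin (πs)`. The hypothesis
-- excludes the poles of `Γ`, where `Gamma` takes the value 0 and the identity fails.
theorem exp_sub_one_mul_Gamma {s : ℂ} (hs : Gamma s ≠ 0) :
    (exp (2 * Real.pi * I * s) - 1) * Gamma s =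
      2 * Real.pi * I * exp (Real.pi * I * s) / Gamma (1 - s) := by
  have h1 := Gamma_mul_Gamma_one_sub s
  have h2 : exp (2 * Real.pi * I * s) - 1 =
      2 * I * exp (Real.pi * I * s) * sin (Real.pi * s) := by
    have e1 : exp (2 * Real.pi * I * s) = exp (Real.pi * I * s) * exp (Real.pi * I * s) := by
      rw [← exp_add]; ring_nf
    have e2 : exp (Real.pi * I * s) * exp (-(Real.pi * I * s)) = 1 := by
      rw [← exp_add]; simp
    have e3 : sin (Real.pi * s) =
        (exp (-(Real.pi * I * s)) - exp (Real.pi * I * s)) * I / 2 := by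
      rw [sin]; ring_nf
    rw [e1, e3]
    linear_combination e2 + (exp (Real.pi * I * s) * exp (Real.pi * I * s) -
      exp (Real.pi * I * s) * exp (-(Real.pi * I * s))) * I_mul_I
  -- If the sine vanishes, `1 - s` is a pole of `Γ`. There `Gamma (1 - s) = 0` and division by it
  -- gives 0, which is the convention `1/Γ = 0` of the theorem, so both sides vanish.
  by_cases hsin : sin (Real.pi * s) = 0
  · have h0 : Gamma (1 - s) = 0 := by
      rw [hsin, div_zero] at h1
      exact (mul_eq_zero.1 h1).resolve_left hs
    rw [h2, hsin, h0]
    simp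
  · have h0 : Gamma (1 - s) ≠ 0 := by
      intro h0
      rw [h0, mul_zero, eq_comm, div_eq_zero_iff] at h1
      exact h1.elim (by exact_mod_cast Real.pi_ne_zero) hsin
    rw [eq_div_iff hsin] at h1
    rw [h2, eq_div_iff h0]
    linear_combination 2 * I * exp (Real.pi * I * s) * h1

open Complex in
theorem integral_joinCycle_fermatForm {m d r : ℕ} (hd : 0 < d) {ζ : ℂ}
    (hζ : ζ = exp (2 * Real.pi * I / d)) (hζd : ζ ^ d = 1) {c : Fin (m + 1) → ℕ}
    (hc : ∀ i, 0 < c i) (hr : ∑ i, c i = d * r) :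
    (joinCycle hd hζd).integral (fermatForm m d c r) =
      (2 * (Real.pi : ℂ) * I) ^ (m + 1) * (-1) ^ r /
        (Gamma (r : ℂ) * ∏ i, Gamma (1 - (c i : ℂ) / (d : ℂ))) := by
  have hd' : (d : ℂ) ≠ 0 := by exact_mod_cast hd.ne'
  have hΓ : ∀ i, (ζ ^ c i - 1) * Gamma ((c i : ℂ) / d) =
      2 * Real.pi * I * exp (Real.pi * I * (c i / d)) / Gamma (1 - (c i : ℂ) / d) := by
    intro i
    have hpos : (0 : ℝ) < c i / d := div_pos (by exact_mod_cast hc i) (by exact_mod_cast hd)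
    have hne : Gamma ((c i : ℂ) / d) ≠ 0 := by
      refine Gamma_ne_zero_of_re_pos ?_
      rwa [show (c i : ℂ) / d = ((c i / d : ℝ) : ℂ) by push_cast; rfl, ofReal_re]
    rw [← exp_sub_one_mul_Gamma hne, hζ, ← exp_nat_mul]
    congr 3
    ring
  -- The exponents add up to `πi |c| / d = πi r`.
  have hexp : ∏ i, exp (Real.pi * I * ((c i : ℂ) / d)) = (-1) ^ r := by
    rw [← exp_sum, ← Finset.mul_sum, ← Finset.sum_div, ← Nat.cast_sum, hr, Nat.cast_mul,
      mul_div_cancel_left₀ _ hd', mul_comm, exp_nat_mul, exp_pi_mul_I]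
  have hJ : ((∫ u in corner m, (∏ i, barycentric u i ^ (c i - 1)) /
      (∑ i, barycentric u i ^ d) ^ r : ℝ) : ℂ) =
      (∏ i, Gamma ((c i : ℂ) / d)) / (d ^ m * Gamma r) := by
    rw [integral_corner hd hc hr]
    push_cast [← Complex.Gamma_ofReal]
    rfl
  calc (joinCycle hd hζd).integral (fermatForm m d c r)
      = -(∑ S, (joinCoeff m d S : ℂ) * ∏ i, rootTuple ζ S i ^ c i) *
          ((∏ i, Gamma ((c i : ℂ) / d)) / (d ^ m * Gamma r)) := by
        rw [integral_joinCycle, ← Finset.sum_neg_distrib, Finset.sum_mul]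
        refine Finset.sum_congr rfl fun S _ => ?_
        rw [joinSimplex, integral_twistedSimplex hd hc hr, hJ]
        ring
    _ = (∏ i, (ζ ^ c i - 1) * Gamma ((c i : ℂ) / d)) / Gamma r := by
        rw [sum_joinCoeff, neg_neg, Finset.prod_mul_distrib, ← mul_div_assoc, mul_assoc,
          mul_div_mul_left _ _ (pow_ne_zero m hd')]
    _ = _ := by
        rw [Finset.prod_congr rfl fun i _ => hΓ i, Finset.prod_div_distrib,
          Finset.prod_mul_distrib, hexp, Finset.prod_const, Finset.card_univ, Fintype.card_fin,
          div_div, mul_comm (Gamma (r : ℂ))]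

end FermatPeriod

end

theorem lemma3p1 (m d : ℕ) (hd : 0 < d) :
    ∃ (δ : FermatPeriod.BettiHomology m d m) (δ₀ : FermatPeriod.SmoothChain m d),
      δ₀.Represents δ ∧
      ∀ (c : Fin (m + 1) → ℕ) (r : ℕ), (∀ i, 0 < c i) → ∑ i, c i = d * r →
        δ₀.integral (FermatPeriod.fermatForm m d c r) =
          (2 * (Real.pi : ℂ) * Complex.I) ^ (m + 1) * (-1) ^ r /
            (Complex.Gamma (r : ℂ) *
              ∏ i, Complex.Gamma (1 - (c i : ℂ) / (d : ℂ))) := by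
  have hζ : Complex.exp (2 * Real.pi * Complex.I / d) ^ d = 1 :=
    (Complex.isPrimitiveRoot_exp d hd.ne').pow_eq_one
  obtain ⟨δ, hδ⟩ := FermatPeriod.SmoothChain.exists_represents _
    (FermatPeriod.d_toChain_joinCycle (m := m) hd hζ)
  exact ⟨δ, _, hδ, fun c r hc hr =>
    FermatPeriod.integral_joinCycle_fermatForm hd rfl hζ hc hr⟩
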